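/- Let $m=(m_k)_{k\ge 0}$ be a bounded sequence of integers $m_k\ge 2$, let $G_m=\prod_{k\ge 0}\mathbb{Z}/m_k\mathbb{Z}$ be the corresponding (bounded) Vilenkin group, and let $\mu$ be its normalized Haar measure, that is, the product of the uniform probability measures on the factors. Put $M_0=1$, $M_{k+1}=m_kM_k$, write each integer $n\ge 0$ as $n=\sum_k n_kM_k$ with $0\le n_k<m_k$, and let $\psi_n(x)=\prod_k \exp(2\pi i\,x_k/m_k)^{n_k}$ $(x\in G_m)$ be the Vilenkin system. For $f\in L^1(G_m)$ let $\widehat f(k)=\int_{G_m} f\,\overline{\psi_k}\,d\mu$ and $S_nf=\sum_{k=0}^{n-1}\widehat f(k)\psi_k$ (so $S_0f=0$). Let $(q_k)_{k\ge 0}$ be a sequence of non-negative real numbers with $q_0>0$, put $Q_n=\sum_{k=0}^{n-1}q_k$, assume $\lim_{n\to\infty}Q_n=\infty$, and define the $T$ means $$T_nf=\frac1{Q_n}\sum_{k=0}^{n-1}q_kS_kf\qquad(n\ge 1).$$ Suppose that either $(q_k)$ is non-increasing, or $(q_k)$ is non-decreasing and $q_{n-1}/Q_n=O(1/n)$ as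 $n\to\infty$. Then, for every $1\le p<\infty$ and every $f\in L^p(G_m)$, $$\lim_{n\to\infty}\|T_nf-f\|_p=0 .$$ -/

import Mathlib

open MeasureTheory Filter Topology Asymptotics
open scoped ENNReal

/-- The Vilenkin group `G_m`: the complete direct product of the cyclic groups `ℤ / m_k ℤ`
(with the product topology, product σ-algebra and coordinatewise addition). -/
abbrev VilenkinGroup (m : ℕ → ℕ) : Type := (k : ℕ) → ZMod (m k)

namespace Vilenkin

/-- The measure `μ_k` on `ℤ / m_k ℤ` giving mass `1 / m_k` to every point. -/
noncomputable def coordMeasure (m : ℕ → ℕ) (k : ℕ) : Measure (ZMod (m k)) :=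
  ((m k : ℝ≥0∞)⁻¹) • Measure.count

/-- The normalized Haar measure `μ` of `G_m`: the direct product of the measures `μ_k`. -/
noncomputable def haar (m : ℕ → ℕ) : Measure (VilenkinGroup m) :=
  Measure.infinitePi (coordMeasure m)

theorem coordMeasure_singleton (m : ℕ → ℕ) (k : ℕ) (j : ZMod (m k)) :
    coordMeasure m k {j} = (m k : ℝ≥0∞)⁻¹ := by
  simp [coordMeasure]

theorem isProbabilityMeasure_coordMeasure {m : ℕ → ℕ} (hm : ∀ k, 2 ≤ m k) (k : ℕ) :
    IsProbabilityMeasure (coordMeasure m k) := by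
  have h0 : m k ≠ 0 := by have := hm k; omega
  haveI : NeZero (m k) := ⟨h0⟩
  constructor
  have hc : (Measure.count : Measure (ZMod (m k))) Set.univ = (m k : ℝ≥0∞) := by
    rw [Measure.count_univ, ENat.card_eq_coe_fintype_card, ZMod.card]
    simp
  rw [coordMeasure, Measure.smul_apply, hc, smul_eq_mul]
  exact ENNReal.inv_mul_cancel (by exact_mod_cast h0) (by simp)

theorem isProbabilityMeasure_haar {m : ℕ → ℕ} (hm : ∀ k, 2 ≤ m k) :
    IsProbabilityMeasure (haar m) := by
  haveI := isProbabilityMeasure_coordMeasure hm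
  unfold haar
  infer_instance

/-- The generalized powers `M_0 = 1`, `M_{k+1} = m_k M_k`. -/
def M (m : ℕ → ℕ) : ℕ → ℕ
  | 0 => 1
  | k + 1 => m k * M m k

/-- The digit `n_k ∈ {0, …, m_k - 1}` in the expansion `n = ∑ n_k M_k`. -/
def digit (m : ℕ → ℕ) (n k : ℕ) : ℕ := n / M m k % m k

theorem two_pow_le_M {m : ℕ → ℕ} (hm : ∀ k, 2 ≤ m k) (k : ℕ) : 2 ^ k ≤ M m k := by
  induction k with
  | zero => simp [M]
  | succ k ih =>
    rw [M, pow_succ, mul_comm]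
    exact Nat.mul_le_mul (hm k) ih

/-- The digits of `n` vanish from position `n` on. -/
theorem digit_eq_zero {m : ℕ → ℕ} (hm : ∀ k, 2 ≤ m k) {n k : ℕ} (h : n ≤ k) :
    digit m n k = 0 := by
  have h1 : n < M m k :=
    lt_of_le_of_lt h (lt_of_lt_of_le Nat.lt_two_pow_self (two_pow_le_M hm k))
  simp [digit, Nat.div_eq_of_lt h1]

/-- The digits have the defining properties of the expansion of `n`. -/
theorem sum_digit {m : ℕ → ℕ} (hm : ∀ k, 2 ≤ m k) (n : ℕ) :
    (∀ k, digit m n k < m k) ∧ ∑ k ∈ Finset.range n, digit m n k * M m k = n := by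
  refine ⟨fun k => Nat.mod_lt _ (by have := hm k; omega), ?_⟩
  have key : ∀ N, ∑ k ∈ Finset.range N, digit m n k * M m k = n % M m N := by
    intro N
    induction N with
    | zero => simp [M, Nat.mod_one]
    | succ N ih =>
      rw [Finset.sum_range_succ, ih, M, mul_comm (m N), Nat.mod_mul, digit]
      ring
  rw [key n]
  exact Nat.mod_eq_of_lt (lt_of_lt_of_le Nat.lt_two_pow_self (two_pow_le_M hm n))

/-- The generalized Rademacher function `r_k(x) = exp(2πi x_k / m_k)`, where `x_k` is represented
in `{0, …, m_k - 1}`. -/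
noncomputable def rademacher (m : ℕ → ℕ) (k : ℕ) (x : VilenkinGroup m) : ℂ :=
  Complex.exp (2 * Real.pi * Complex.I * ((x k).val : ℂ) / (m k : ℂ))

/-- The Vilenkin function `ψ_n = ∏_k r_k ^ {n_k}`; the factors with `k ≥ n` equal `1`, because
the digits `n_k` vanish there. -/
noncomputable def psi (m : ℕ → ℕ) (n : ℕ) (x : VilenkinGroup m) : ℂ :=
  ∏ k ∈ Finset.range n, rademacher m k x ^ digit m n k

/-- The Vilenkin-Fourier coefficient of `f`. -/
noncomputable def fourierCoeff (m : ℕ → ℕ) (f : VilenkinGroup m → ℂ) (k : ℕ) : ℂ :=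
  ∫ x, f x * (starRingEnd ℂ) (psi m k x) ∂(haar m)

/-- The partial sum `S_n f` of the Vilenkin-Fourier series; `S_0 f = 0`. -/
noncomputable def partialSum (m : ℕ → ℕ) (f : VilenkinGroup m → ℂ) (n : ℕ)
    (x : VilenkinGroup m) : ℂ :=
  ∑ k ∈ Finset.range n, fourierCoeff m f k * psi m k x

/-- `Q_n = q_0 + … + q_{n-1}`. -/
def Q (q : ℕ → ℝ) (n : ℕ) : ℝ := ∑ k ∈ Finset.range n, q k

/-- The `n`-th `T` mean `T_n f = (1 / Q_n) ∑_{k=0}^{n-1} q_k S_k f` (for `n ≥ 1`). -/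
noncomputable def tMean (m : ℕ → ℕ) (q : ℕ → ℝ) (f : VilenkinGroup m → ℂ) (n : ℕ)
    (x : VilenkinGroup m) : ℂ :=
  ((1 / Q q n : ℝ) : ℂ) * ∑ k ∈ Finset.range n, (q k : ℂ) * partialSum m f k x

end Vilenkin

namespace Vilenkin

/-! The means `T_n` are eventually uniformly bounded on `Lᵖ`, and they converge on the Vilenkin
polynomials, which are dense. An approximation argument then gives convergence everywhere.

For the bound, summation by parts rewrites `∑ q_k S_k f` through the sums `A_n = ∑_{k<n} S_k f`. By
Schur's test `‖A_n‖ ≤ c n ‖f‖` as soon as the Fejér kernels are bounded in `L¹`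
(`lintegral_fejerSum_le`); this is where boundedness of `m` enters. What remains is the weighted
variation of `q`. It equals `Q_n` for non-increasing `q`, and `2 n q_{n-1} - Q_n` for non-decreasing
`q`, which the growth condition makes `O(Q_n)`.

The kernel estimate rests on the digit structure: `ψ_{sM_k+j} = r_k^s ψ_j` for `j < M_k`. Hence the
kernels split into blocks, and `D_{M_k}` is a product of kernels in single, independent coordinates,
of `L¹` norm 1.

On polynomials, `T_n ψ_j - ψ_j` is `-Q_{j+1}/Q_n` times `ψ_j`, and `Q_n → ∞`. -/

/-! ### Digits and factorization of the Vilenkin functions -/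

theorem digit_mul_M_add {m : ℕ → ℕ} (hm : ∀ k, 2 ≤ m k) {k s j : ℕ} (hs : s < m k)
    (hj : j < M m k) (i : ℕ) :
    digit m (s * M m k + j) i = if i = k then s else digit m j i := by
  have hpos : ∀ i, 0 < M m i := fun i => lt_of_lt_of_le (by positivity) (two_pow_le_M hm i)
  have hdvd : ∀ {a b : ℕ}, a ≤ b → M m a ∣ M m b := fun {a b} hab =>
    Nat.le_induction (m := a) (P := fun b _ => M m a ∣ M m b) dvd_rfl
      (fun n _ h => h.trans (Dvd.intro_left (m n) rfl)) b hab
  rcases lt_trichotomy i k with h | rfl | h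
  · rw [if_neg h.ne]
    -- A digit below position `k` depends only on `n` modulo `M_{i+1}`, which divides `M_k`.
    have key : ∀ n, digit m n i = n % M m (i + 1) / M m i := fun n => by
      rw [digit, M, mul_comm, Nat.mod_mul_right_div_self]
    obtain ⟨c, hc⟩ := hdvd (Nat.succ_le_of_lt h)
    rw [key, key, hc, show s * (M m i.succ * c) + j = j + M m (i + 1) * (s * c) by
      simp only [Nat.succ_eq_add_one]; ring, Nat.add_mul_mod_self_left]
  · rw [if_pos rfl, digit, add_comm, Nat.add_mul_div_right _ _ (hpos _), Nat.div_eq_of_lt hj,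
      zero_add, Nat.mod_eq_of_lt hs]
  · rw [if_neg h.ne']
    have h1 : M m (k + 1) ≤ M m i := Nat.le_of_dvd (hpos _) (hdvd h)
    have h2 : s * M m k + j < M m i := by
      refine lt_of_lt_of_le ?_ h1
      rw [M]
      calc s * M m k + j < (s + 1) * M m k := by rw [add_mul, one_mul]; omega
        _ ≤ m k * M m k := Nat.mul_le_mul_right _ hs
    have h3 : j < M m i := lt_of_le_of_lt (Nat.le_add_left _ _) h2
    simp [digit, Nat.div_eq_of_lt h2, Nat.div_eq_of_lt h3]

theorem psi_eq_prod {m : ℕ → ℕ} (hm : ∀ k, 2 ≤ m k) {n N : ℕ} (h : n ≤ N)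
    (x : VilenkinGroup m) :
    psi m n x = ∏ k ∈ Finset.range N, rademacher m k x ^ digit m n k := by
  rw [psi]
  refine Finset.prod_subset (Finset.range_mono h) fun k _ hk => ?_
  rw [digit_eq_zero hm (by simpa using hk), pow_zero]

theorem psi_mul_M_add {m : ℕ → ℕ} (hm : ∀ k, 2 ≤ m k) {k s j : ℕ} (hs : s < m k)
    (hj : j < M m k) (x : VilenkinGroup m) :
    psi m (s * M m k + j) x = rademacher m k x ^ s * psi m j x := by
  -- The product defining `psi` stops at its own index, so both are extended to a common range that
  -- contains `k`.
  set N := max (s * M m k + j) (k + 1)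
  have hk : k ∈ Finset.range N := Finset.mem_range.2 (lt_of_lt_of_le k.lt_succ_self (le_max_right _ _))
  have h0 : digit m j k = 0 := by simp [digit, Nat.div_eq_of_lt hj]
  rw [psi_eq_prod hm (le_max_left (s * M m k + j) (k + 1)),
    psi_eq_prod hm (N := N) ((Nat.le_add_left _ _).trans (le_max_left _ _)),
    ← Finset.mul_prod_erase _ _ hk, ← Finset.mul_prod_erase _ _ hk, h0, pow_zero, one_mul,
    digit_mul_M_add hm hs hj, if_pos rfl]
  congr 1
  refine Finset.prod_congr rfl fun i hi => ?_
  rw [digit_mul_M_add hm hs hj, if_neg (Finset.ne_of_mem_erase hi)]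

theorem psi_zero (m : ℕ → ℕ) (x : VilenkinGroup m) : psi m 0 x = 1 := by simp [psi]

theorem rademacher_eq_stdAddChar (m : ℕ → ℕ) [∀ k, NeZero (m k)] (k : ℕ) (x : VilenkinGroup m) :
    rademacher m k x = ZMod.stdAddChar (x k) := by
  rw [ZMod.stdAddChar_apply, ZMod.toCircle_apply, rademacher]

theorem norm_stdAddChar {n : ℕ} [NeZero n] (a : ZMod n) : ‖ZMod.stdAddChar a‖ = 1 := by
  rw [ZMod.stdAddChar_apply]; exact Circle.norm_coe _

theorem conj_stdAddChar {n : ℕ} [NeZero n] (a : ZMod n) :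
    (starRingEnd ℂ) (ZMod.stdAddChar a) = ZMod.stdAddChar (-a) := by
  rw [AddChar.map_neg_eq_inv, Complex.inv_eq_conj (norm_stdAddChar a)]

theorem norm_rademacher (m : ℕ → ℕ) [∀ k, NeZero (m k)] (k : ℕ) (x : VilenkinGroup m) :
    ‖rademacher m k x‖ = 1 := by
  rw [rademacher_eq_stdAddChar, norm_stdAddChar]

theorem norm_psi (m : ℕ → ℕ) [∀ k, NeZero (m k)] (n : ℕ) (x : VilenkinGroup m) :
    ‖psi m n x‖ = 1 := by
  simp [psi, norm_rademacher]

theorem measurable_rademacher (m : ℕ → ℕ) (k : ℕ) : Measurable (rademacher m k) :=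
  (measurable_from_top (f := fun a : ZMod (m k) =>
    Complex.exp (2 * Real.pi * Complex.I * (a.val : ℂ) / (m k : ℂ)))).comp (measurable_pi_apply k)

theorem measurable_psi (m : ℕ → ℕ) (n : ℕ) : Measurable (psi m n) :=
  Finset.measurable_fun_prod _ fun k _ => (measurable_rademacher m k).pow_const _

/-! ### Block identities for the Dirichlet and Fejér kernels -/

/-- `r_k(x)` times the conjugate of `r_k(t)`. -/
noncomputable def phase (m : ℕ → ℕ) (k : ℕ) (x t : VilenkinGroup m) : ℂ :=
  rademacher m k x * (starRingEnd ℂ) (rademacher m k t)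

/-- The `n`-th Dirichlet kernel, as a function of two variables. -/
noncomputable def dirichlet (m : ℕ → ℕ) (n : ℕ) (x t : VilenkinGroup m) : ℂ :=
  ∑ j ∈ Finset.range n, psi m j x * (starRingEnd ℂ) (psi m j t)

/-- The sum of the first `n` Dirichlet kernels, that is, `n` times the Fejér kernel. -/
noncomputable def fejerSum (m : ℕ → ℕ) (n : ℕ) (x t : VilenkinGroup m) : ℂ :=
  ∑ j ∈ Finset.range n, dirichlet m j x t

/-- The Dirichlet kernel of the `k`-th factor. -/
noncomputable def coordKernel (m : ℕ → ℕ) (k : ℕ) (x t : VilenkinGroup m) : ℂ :=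
  ∑ l ∈ Finset.range (m k), phase m k x t ^ l

theorem phase_eq_stdAddChar (m : ℕ → ℕ) [∀ k, NeZero (m k)] (k : ℕ) (x t : VilenkinGroup m) :
    phase m k x t = ZMod.stdAddChar (x k - t k) := by
  rw [phase, rademacher_eq_stdAddChar, rademacher_eq_stdAddChar, conj_stdAddChar, sub_eq_add_neg,
    AddChar.map_add_eq_mul]

theorem norm_phase (m : ℕ → ℕ) [∀ k, NeZero (m k)] (k : ℕ) (x t : VilenkinGroup m) :
    ‖phase m k x t‖ = 1 := by
  rw [phase_eq_stdAddChar, norm_stdAddChar]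

/-- The phase is an `m_k`-th root of unity, equal to 1 only when the coordinates agree because the
standard character is injective; otherwise the geometric sum vanishes. -/
theorem coordKernel_eq_ite (m : ℕ → ℕ) [∀ k, NeZero (m k)] (k : ℕ) (x t : VilenkinGroup m) :
    coordKernel m k x t = if x k = t k then (m k : ℂ) else 0 := by
  rw [coordKernel, phase_eq_stdAddChar]
  split_ifs with h
  · simp [h]
  · have h1 : ZMod.stdAddChar (x k - t k) ≠ 1 := fun h2 =>
      h (sub_eq_zero.1 (ZMod.injective_stdAddChar (h2.trans (AddChar.map_zero_eq_one _).symm)))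
    have h2 : (ZMod.stdAddChar (x k - t k) : ℂ) ^ m k = 1 := by
      rw [← AddChar.map_nsmul_eq_pow]; simp
    rw [geom_sum_eq h1, h2, sub_self, zero_div]

theorem dirichlet_mul_M_add {m : ℕ → ℕ} (hm : ∀ k, 2 ≤ m k) {k s r : ℕ} (hs : s < m k)
    (hr : r ≤ M m k) (x t : VilenkinGroup m) :
    dirichlet m (s * M m k + r) x t =
      dirichlet m (s * M m k) x t + phase m k x t ^ s * dirichlet m r x t := by
  rw [dirichlet, Finset.sum_range_add, dirichlet, dirichlet, Finset.mul_sum]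
  congr 1
  refine Finset.sum_congr rfl fun j hj => ?_
  have hj' : j < M m k := lt_of_lt_of_le (Finset.mem_range.1 hj) hr
  rw [psi_mul_M_add hm hs hj', psi_mul_M_add hm hs hj', phase, map_mul, map_pow]
  ring

theorem dirichlet_mul_M {m : ℕ → ℕ} (hm : ∀ k, 2 ≤ m k) {k s : ℕ} (hs : s ≤ m k)
    (x t : VilenkinGroup m) :
    dirichlet m (s * M m k) x t =
      (∑ l ∈ Finset.range s, phase m k x t ^ l) * dirichlet m (M m k) x t := by
  induction s with
  | zero => simp [dirichlet]
  | succ s ih =>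
    rw [add_mul, one_mul, dirichlet_mul_M_add hm hs le_rfl, ih (Nat.le_of_succ_le hs),
      Finset.sum_range_succ, add_mul]

theorem dirichlet_M {m : ℕ → ℕ} (hm : ∀ k, 2 ≤ m k) (k : ℕ) (x t : VilenkinGroup m) :
    dirichlet m (M m k) x t = ∏ j ∈ Finset.range k, coordKernel m j x t := by
  induction k with
  | zero => simp [dirichlet, M, psi_zero]
  | succ k ih =>
    rw [M, dirichlet_mul_M hm le_rfl, ih, Finset.prod_range_succ, coordKernel, mul_comm]

theorem fejerSum_mul_M_add {m : ℕ → ℕ} (hm : ∀ k, 2 ≤ m k) {k s r : ℕ} (hs : s < m k)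
    (hr : r ≤ M m k) (x t : VilenkinGroup m) :
    fejerSum m (s * M m k + r) x t =
      fejerSum m (s * M m k) x t
        + r * ((∑ l ∈ Finset.range s, phase m k x t ^ l) * dirichlet m (M m k) x t)
        + phase m k x t ^ s * fejerSum m r x t := by
  rw [fejerSum, Finset.sum_range_add, ← fejerSum, add_assoc]
  congr 1
  rw [Finset.sum_congr rfl fun j hj => dirichlet_mul_M_add hm hs
    ((Finset.mem_range.1 hj).le.trans hr) x t, Finset.sum_add_distrib, Finset.sum_const,
    Finset.card_range, nsmul_eq_mul, ← Finset.mul_sum, dirichlet_mul_M hm hs.le, fejerSum]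

theorem fejerSum_mul_M {m : ℕ → ℕ} (hm : ∀ k, 2 ≤ m k) {k s : ℕ} (hs : s ≤ m k)
    (x t : VilenkinGroup m) :
    fejerSum m (s * M m k) x t =
      M m k * (∑ l ∈ Finset.range s, ∑ i ∈ Finset.range l, phase m k x t ^ i)
          * dirichlet m (M m k) x t
        + (∑ l ∈ Finset.range s, phase m k x t ^ l) * fejerSum m (M m k) x t := by
  induction s with
  | zero => simp [fejerSum]
  | succ s ih =>
    rw [add_mul, one_mul, fejerSum_mul_M_add hm hs le_rfl, ih (Nat.le_of_succ_le hs),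
      Finset.sum_range_succ, Finset.sum_range_succ]
    ring

theorem enorm_geom_sum_le (m : ℕ → ℕ) [∀ k, NeZero (m k)] (k s : ℕ) (x t : VilenkinGroup m) :
    ‖∑ l ∈ Finset.range s, phase m k x t ^ l‖ₑ ≤ s := by
  refine (enorm_sum_le _ _).trans ?_
  have h : ‖phase m k x t‖ₑ = 1 := by rw [← ofReal_norm, norm_phase, ENNReal.ofReal_one]
  simp [enorm_pow, h]

theorem enorm_sum_geom_sum_le (m : ℕ → ℕ) [∀ k, NeZero (m k)] (k s : ℕ) (x t : VilenkinGroup m) :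
    ‖∑ l ∈ Finset.range s, ∑ i ∈ Finset.range l, phase m k x t ^ i‖ₑ ≤ s * s := by
  refine (enorm_sum_le _ _).trans ?_
  refine (Finset.sum_le_card_nsmul _ _ (s : ℝ≥0∞) fun l hl => ?_).trans (by simp)
  refine (enorm_geom_sum_le m k l x t).trans ?_
  exact_mod_cast (Finset.mem_range.1 hl).le

theorem enorm_fejerSum_mul_M_add_le {m : ℕ → ℕ} [∀ k, NeZero (m k)] (hm : ∀ k, 2 ≤ m k)
    {k s r : ℕ} (hs : s < m k) (hr : r ≤ M m k) (x t : VilenkinGroup m) :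
    ‖fejerSum m (s * M m k + r) x t‖ₑ ≤
      (M m k * (s * s) + r * s) * ‖dirichlet m (M m k) x t‖ₑ
        + s * ‖fejerSum m (M m k) x t‖ₑ + ‖fejerSum m r x t‖ₑ := by
  have h : ‖phase m k x t‖ₑ = 1 := by rw [← ofReal_norm, norm_phase, ENNReal.ofReal_one]
  have hn : ∀ n : ℕ, ‖(n : ℂ)‖ₑ = n := fun n => by simp [← ofReal_norm]
  rw [fejerSum_mul_M_add hm hs hr, fejerSum_mul_M hm hs.le]
  refine (enorm_add_le _ _).trans ?_
  refine (add_le_add_left ((enorm_add_le _ _).trans (add_le_add_left (enorm_add_le _ _) _))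
    _).trans ?_
  simp only [enorm_mul, enorm_pow, h, hn, one_pow, one_mul]
  calc _ ≤ M m k * (s * s) * ‖dirichlet m (M m k) x t‖ₑ + s * ‖fejerSum m (M m k) x t‖ₑ
        + r * (s * ‖dirichlet m (M m k) x t‖ₑ) + ‖fejerSum m r x t‖ₑ := by
        gcongr
        · exact enorm_sum_geom_sum_le ..
        · exact enorm_geom_sum_le ..
        · exact enorm_geom_sum_le ..
    _ = _ := by ring

/-- Passing from `M_K` to `M_{K+1}` multiplies the old kernel by `coordKernel K` and adds a term in
which that factor is replaced by a double sum of size at most `B²`. Unrolling leaves, for each `k`,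
a product missing exactly the factor `k`, and such products still integrate to 1. -/
theorem enorm_fejerSum_M_le {m : ℕ → ℕ} [∀ k, NeZero (m k)] (hm : ∀ k, 2 ≤ m k) {B : ℕ}
    (hB : ∀ k, m k ≤ B) (K : ℕ) (x t : VilenkinGroup m) :
    ‖fejerSum m (M m K) x t‖ₑ ≤ ∑ k ∈ Finset.range K, (B * B : ℝ≥0∞) * M m k
      * ∏ j ∈ (Finset.range K).erase k, ‖coordKernel m j x t‖ₑ := by
  have hn : ∀ n : ℕ, ‖(n : ℂ)‖ₑ = n := fun n => by simp [← ofReal_norm]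
  have henorm_prod : ∀ s : Finset ℕ, ‖∏ j ∈ s, coordKernel m j x t‖ₑ
      = ∏ j ∈ s, ‖coordKernel m j x t‖ₑ := fun s => by
    induction s using Finset.cons_induction with
    | empty => simp
    | cons a s ha ih => rw [Finset.prod_cons, Finset.prod_cons, enorm_mul, ih]
  induction K with
  | zero => simp [fejerSum, M, dirichlet]
  | succ K ih =>
    rw [M, fejerSum_mul_M hm le_rfl, Finset.sum_range_succ, add_comm]
    refine (enorm_add_le _ _).trans (add_le_add ?_ ?_)
    · rw [enorm_mul, ← coordKernel, mul_comm]
      refine (mul_le_mul_left ih _).trans ?_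
      rw [Finset.sum_mul]
      refine (Finset.sum_congr rfl fun k hk => ?_).le
      have hk' : K ≠ k := (Finset.mem_range.1 hk).ne'
      rw [Finset.range_add_one, Finset.erase_insert_of_ne hk', Finset.prod_insert (by simp),
        mul_assoc, mul_comm (∏ j ∈ _, _)]
    · rw [enorm_mul, enorm_mul, hn, dirichlet_M hm, henorm_prod, Finset.range_add_one,
        Finset.erase_insert (by simp), mul_comm (M m K : ℝ≥0∞)]
      gcongr
      refine (enorm_sum_geom_sum_le m K (m K) x t).trans ?_
      gcongr <;> exact hB K

/-! ### `L¹` bounds for the kernels -/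

theorem measurable_dirichlet (m : ℕ → ℕ) (n : ℕ) :
    Measurable (Function.uncurry (dirichlet m n)) := by
  have : Function.uncurry (dirichlet m n) = fun z : VilenkinGroup m × VilenkinGroup m =>
      ∑ j ∈ Finset.range n, psi m j z.1 * (starRingEnd ℂ) (psi m j z.2) := rfl
  rw [this]
  refine Finset.measurable_fun_sum _ fun j _ => ?_
  exact ((measurable_psi m j).comp measurable_fst).mul
    (Complex.continuous_conj.measurable.comp ((measurable_psi m j).comp measurable_snd))

theorem measurable_fejerSum (m : ℕ → ℕ) (n : ℕ) :
    Measurable (Function.uncurry (fejerSum m n)) := by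
  have : Function.uncurry (fejerSum m n) = fun z : VilenkinGroup m × VilenkinGroup m =>
      ∑ j ∈ Finset.range n, Function.uncurry (dirichlet m j) z := rfl
  rw [this]
  exact Finset.measurable_fun_sum _ fun j _ => measurable_dirichlet m j

theorem measurable_coordKernel (m : ℕ → ℕ) (k : ℕ) (t : VilenkinGroup m) :
    Measurable fun x => coordKernel m k x t :=
  Finset.measurable_fun_sum _ fun _ _ =>
    ((measurable_rademacher m k).mul measurable_const).pow_const _

/-- The factors are independent, and each is `m_j` times the indicator of a point of mass `1 / m_j`.
-/
theorem lintegral_prod_coordKernel {m : ℕ → ℕ} [∀ k, NeZero (m k)] (hm : ∀ k, 2 ≤ m k)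
    (s : Finset ℕ) (t : VilenkinGroup m) :
    ∫⁻ x, ∏ j ∈ s, ‖coordKernel m j x t‖ₑ ∂haar m = 1 := by
  have := isProbabilityMeasure_coordMeasure hm
  let g : (j : ℕ) → ZMod (m j) → ℝ≥0∞ := fun j => ({t j} : Set (ZMod (m j))).indicator
    fun _ => (m j : ℝ≥0∞)
  have hg : ∀ j, Measurable (g j) := fun j => measurable_from_top
  have h1 : ∀ j x, ‖coordKernel m j x t‖ₑ = g j (x j) := fun j x => by
    rw [coordKernel_eq_ite]
    by_cases h : x j = t j
    · simp [g, h, ← ofReal_norm]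
    · simp [g, h]
  simp only [h1]
  have hind := ProbabilityTheory.iIndepFun_infinitePi (P := coordMeasure m) (X := g) hg
  rw [show haar m = Measure.infinitePi (coordMeasure m) from rfl,
    ProbabilityTheory.lintegral_prod_eq_prod_lintegral_of_indepFun s _ hind
      fun j => (hg j).comp (measurable_pi_apply j)]
  refine Finset.prod_eq_one fun j _ => ?_
  rw [← lintegral_map (hg j) (measurable_pi_apply j), Measure.infinitePi_map_eval,
    lintegral_indicator_const (measurableSet_singleton _), coordMeasure_singleton]
  exact ENNReal.mul_inv_cancel (by exact_mod_cast NeZero.ne (m j)) (by simp)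

theorem lintegral_dirichlet_M {m : ℕ → ℕ} [∀ k, NeZero (m k)] (hm : ∀ k, 2 ≤ m k)
    (k : ℕ) (t : VilenkinGroup m) :
    ∫⁻ x, ‖dirichlet m (M m k) x t‖ₑ ∂haar m = 1 := by
  rw [← lintegral_prod_coordKernel hm (Finset.range k) t]
  refine lintegral_congr fun x => ?_
  rw [dirichlet_M hm, ← ofReal_norm, norm_prod, ENNReal.ofReal_prod_of_nonneg fun _ _ => norm_nonneg _]
  simp only [ofReal_norm]

theorem sum_M_le {m : ℕ → ℕ} (hm : ∀ k, 2 ≤ m k) (K : ℕ) :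
    ∑ k ∈ Finset.range K, M m k ≤ M m K := by
  induction K with
  | zero => simp
  | succ K ih =>
    rw [Finset.sum_range_succ, M]
    have := Nat.mul_le_mul_right (M m K) (hm K)
    omega

theorem lintegral_fejerSum_M_le {m : ℕ → ℕ} [∀ k, NeZero (m k)] (hm : ∀ k, 2 ≤ m k) {B : ℕ}
    (hB : ∀ k, m k ≤ B) (K : ℕ) (t : VilenkinGroup m) :
    ∫⁻ x, ‖fejerSum m (M m K) x t‖ₑ ∂haar m ≤ B * B * M m K := by
  refine (lintegral_mono fun x => enorm_fejerSum_M_le hm hB K x t).trans ?_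
  rw [lintegral_finsetSum' _ fun k _ => Measurable.aemeasurable <| Measurable.const_mul
    (Finset.measurable_fun_prod _ fun j _ => (measurable_coordKernel m j t).enorm) _]
  have : ∀ k, ∫⁻ x, (B * B : ℝ≥0∞) * M m k
      * ∏ j ∈ (Finset.range K).erase k, ‖coordKernel m j x t‖ₑ ∂haar m = B * B * M m k := fun k => by
    rw [lintegral_const_mul _
      (Finset.measurable_fun_prod _ fun j _ => (measurable_coordKernel m j t).enorm),
      lintegral_prod_coordKernel hm, mul_one]
  simp only [this]
  rw [← Finset.mul_sum]
  gcongr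
  exact_mod_cast sum_M_le hm K

/-- The Fejér kernels of a bounded Vilenkin group are uniformly integrable in norm. -/
theorem lintegral_fejerSum_le {m : ℕ → ℕ} [∀ k, NeZero (m k)] (hm : ∀ k, 2 ≤ m k) {B : ℕ}
    (hB : ∀ k, m k ≤ B) (n : ℕ) (t : VilenkinGroup m) :
    ∫⁻ x, ‖fejerSum m n x t‖ₑ ∂haar m ≤ (B * B + B + B : ℕ) * n := by
  -- Induction on the number of digits: the leading digit `s` is split off and the remainder `r` is
  -- handled by the hypothesis.
  suffices H : ∀ k n, n < M m k →
      ∫⁻ x, ‖fejerSum m n x t‖ₑ ∂haar m ≤ (B * B + B + B : ℕ) * n from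
    H n n (Nat.lt_two_pow_self.trans_le (two_pow_le_M hm n))
  intro k
  induction k with
  | zero =>
    intro n hn
    obtain rfl : n = 0 := by simpa [M] using hn
    simp [fejerSum]
  | succ k ih =>
    intro n hn
    have hpos : 0 < M m k := lt_of_lt_of_le (by positivity) (two_pow_le_M hm k)
    set s := n / M m k
    set r := n % M m k
    have hr : r < M m k := Nat.mod_lt _ hpos
    have hs : s < m k := (Nat.div_lt_iff_lt_mul hpos).2 hn
    have hn' : n = s * M m k + r := by rw [mul_comm]; exact (Nat.div_add_mod n (M m k)).symm
    have hmeas : ∀ n, Measurable fun x => ‖fejerSum m n x t‖ₑ := fun n =>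
      ((measurable_fejerSum m n).comp (measurable_id.prodMk measurable_const)).enorm
    have hmeasD : Measurable fun x => ‖dirichlet m (M m k) x t‖ₑ :=
      ((measurable_dirichlet m _).comp (measurable_id.prodMk measurable_const)).enorm
    rw [hn']
    refine (lintegral_mono fun x => enorm_fejerSum_mul_M_add_le hm hs hr.le x t).trans ?_
    rw [lintegral_add_right _ (hmeas r), lintegral_add_right _ ((hmeas _).const_mul _),
      lintegral_const_mul _ hmeasD, lintegral_const_mul _ (hmeas _), lintegral_dirichlet_M hm]
    calc _ ≤ (M m k * (s * s) + r * s : ℝ≥0∞) * 1 + s * (B * B * M m k)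
              + (B * B + B + B : ℕ) * r := by
          gcongr
          · exact lintegral_fejerSum_M_le hm hB k t
          · exact ih r hr
      -- With `r ≤ M_k` and `s ≤ B`, the leading block costs at most `(B² + 2B) s M_k`, proportional
      -- to its length, so the same constant survives the induction.
      _ ≤ (M m k * (s * B) + M m k * (s * B) : ℝ≥0∞) * 1 + s * (B * B * M m k)
          + (B * B + B + B : ℕ) * r := by
          have h1 : s ≤ B := hs.le.trans (hB k)
          have h2 : s ≤ s * B :=
            Nat.le_mul_of_pos_right _ (by have := hm k; have := hB k; omega)
          gcongr
          exact_mod_cast h2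
      _ = _ := by push_cast; ring

/-! ### Schur's test and the `Lᵖ` bound for sums of partial sums -/

theorem conj_dirichlet (m : ℕ → ℕ) (n : ℕ) (x t : VilenkinGroup m) :
    (starRingEnd ℂ) (dirichlet m n x t) = dirichlet m n t x := by
  simp [dirichlet, mul_comm]

/-- Hermitian symmetry transfers the `L¹` bound from one variable to the other, as Schur's test
requires. -/
theorem conj_fejerSum (m : ℕ → ℕ) (n : ℕ) (x t : VilenkinGroup m) :
    (starRingEnd ℂ) (fejerSum m n x t) = fejerSum m n t x := by
  simp [fejerSum, conj_dirichlet]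

/-- **Schur's test**: an integral operator whose kernel has `L¹` norm at most `C` in each variable
is bounded on `Lᵖ` with norm at most `C`. -/
theorem _root_.MeasureTheory.eLpNorm_integral_mul_kernel_le {α : Type*} [MeasurableSpace α]
    {μ : Measure α} [SFinite μ] {K : α → α → ℂ} (hK : Measurable (Function.uncurry K))
    {C : ℝ≥0∞} (hC : C ≠ ∞) (hK₁ : ∀ x, ∫⁻ t, ‖K x t‖ₑ ∂μ ≤ C) (hK₂ : ∀ t, ∫⁻ x, ‖K x t‖ₑ ∂μ ≤ C)
    {p : ℝ≥0∞} (hp1 : 1 ≤ p) (hp : p ≠ ∞) {f : α → ℂ} (hf : AEStronglyMeasurable f μ) :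
    eLpNorm (fun x => ∫ t, f t * K x t ∂μ) p μ ≤ C * eLpNorm f p μ := by
  have hp0 : p ≠ 0 := (zero_lt_one.trans_le hp1).ne'
  set r := p.toReal
  have hr1 : 1 ≤ r := by simpa [r] using ENNReal.toReal_mono hp hp1
  have hr0 : 0 < r := zero_lt_one.trans_le hr1
  have hfe : AEMeasurable (fun t => ‖f t‖ₑ) μ := hf.enorm
  have hKx : ∀ x, Measurable fun t => ‖K x t‖ₑ := fun x =>
    (hK.comp measurable_prodMk_left).enorm
  have hKt : ∀ t, Measurable fun x => ‖K x t‖ₑ := fun t =>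
    (hK.comp measurable_prodMk_right).enorm
  have hq : 0 ≤ 1 - 1 / r := sub_nonneg.2 ((div_le_one hr0).2 hr1)
  have hpt : ∀ x, ‖∫ t, f t * K x t ∂μ‖ₑ ^ r ≤ (∫⁻ t, ‖f t‖ₑ ^ r * ‖K x t‖ₑ ∂μ) * C ^ (r - 1) := by
    intro x
    calc ‖∫ t, f t * K x t ∂μ‖ₑ ^ r ≤ (∫⁻ t, ‖f t * K x t‖ₑ ∂μ) ^ r := by
          gcongr; exact enorm_integral_le_lintegral_enorm _
      -- Splitting `|K|` prepares Hölder with weights `1/r` and `1 - 1/r`; the weighted form also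
      -- covers `r = 1`.
      _ = (∫⁻ t, (‖f t‖ₑ ^ r * ‖K x t‖ₑ) ^ (1 / r) * ‖K x t‖ₑ ^ (1 - 1 / r) ∂μ) ^ r := by
          congr 1
          refine lintegral_congr fun t => ?_
          rw [enorm_mul, ENNReal.mul_rpow_of_nonneg _ _ (by positivity), ← ENNReal.rpow_mul,
            mul_one_div_cancel hr0.ne', ENNReal.rpow_one, mul_assoc,
            ← ENNReal.rpow_add_of_nonneg _ _ (by positivity) hq, add_sub_cancel, ENNReal.rpow_one]
      _ ≤ ((∫⁻ t, ‖f t‖ₑ ^ r * ‖K x t‖ₑ ∂μ) ^ (1 / r) * (∫⁻ t, ‖K x t‖ₑ ∂μ) ^ (1 - 1 / r)) ^ r := by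
          gcongr
          exact ENNReal.lintegral_mul_norm_pow_le ((hfe.pow_const _).mul (hKx x).aemeasurable)
            (hKx x).aemeasurable (by positivity) hq (by ring)
      _ ≤ ((∫⁻ t, ‖f t‖ₑ ^ r * ‖K x t‖ₑ ∂μ) ^ (1 / r) * C ^ (1 - 1 / r)) ^ r := by
          gcongr
          exact hK₁ x
      _ = _ := by
          rw [ENNReal.mul_rpow_of_nonneg _ _ hr0.le, ← ENNReal.rpow_mul, ← ENNReal.rpow_mul,
            one_div_mul_cancel hr0.ne', ENNReal.rpow_one, sub_mul, one_mul,
            one_div_mul_cancel hr0.ne']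
  have hmain : ∫⁻ x, ‖∫ t, f t * K x t ∂μ‖ₑ ^ r ∂μ ≤ C ^ r * ∫⁻ t, ‖f t‖ₑ ^ r ∂μ := by
    calc ∫⁻ x, ‖∫ t, f t * K x t ∂μ‖ₑ ^ r ∂μ
        ≤ ∫⁻ x, (∫⁻ t, ‖f t‖ₑ ^ r * ‖K x t‖ₑ ∂μ) * C ^ (r - 1) ∂μ := lintegral_mono hpt
      _ = (∫⁻ x, ∫⁻ t, ‖f t‖ₑ ^ r * ‖K x t‖ₑ ∂μ ∂μ) * C ^ (r - 1) :=
          lintegral_mul_const' _ _ (ENNReal.rpow_ne_top_of_nonneg (by linarith) hC)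
      _ = (∫⁻ t, ∫⁻ x, ‖f t‖ₑ ^ r * ‖K x t‖ₑ ∂μ ∂μ) * C ^ (r - 1) := by
          rw [lintegral_lintegral_swap]
          exact ((hfe.pow_const r).comp_quasiMeasurePreserving
            Measure.quasiMeasurePreserving_snd).mul hK.enorm.aemeasurable
      _ ≤ (∫⁻ t, ‖f t‖ₑ ^ r * C ∂μ) * C ^ (r - 1) := by
          gcongr with t
          rw [lintegral_const_mul _ (hKt t)]
          gcongr
          exact hK₂ t
      _ = _ := by
          rw [lintegral_mul_const' _ _ hC, mul_assoc, mul_comm]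
          congr 1
          nth_rw 1 [← ENNReal.rpow_one C]
          rw [← ENNReal.rpow_add_of_nonneg _ _ zero_le_one (by linarith), add_sub_cancel]
  rw [eLpNorm_eq_lintegral_rpow_enorm_toReal hp0 hp, eLpNorm_eq_lintegral_rpow_enorm_toReal hp0 hp]
  calc _ ≤ (C ^ r * ∫⁻ t, ‖f t‖ₑ ^ r ∂μ) ^ (1 / r) := by gcongr
    _ = _ := by
      rw [ENNReal.mul_rpow_of_nonneg _ _ (by positivity), ← ENNReal.rpow_mul,
        mul_one_div_cancel hr0.ne', ENNReal.rpow_one]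

theorem integrable_mul_conj_psi {m : ℕ → ℕ} [∀ k, NeZero (m k)] {f : VilenkinGroup m → ℂ}
    (hf : Integrable f (haar m)) (k : ℕ) :
    Integrable (fun x => f x * (starRingEnd ℂ) (psi m k x)) (haar m) :=
  hf.mul_bdd (c := 1)
    (Complex.continuous_conj.measurable.comp (measurable_psi m k)).aestronglyMeasurable
    (ae_of_all _ fun x => by simp [norm_psi])

theorem partialSum_eq_integral {m : ℕ → ℕ} [∀ k, NeZero (m k)] {f : VilenkinGroup m → ℂ}
    (hf : Integrable f (haar m)) (n : ℕ) (x : VilenkinGroup m) :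
    Integrable (fun t => f t * dirichlet m n x t) (haar m) ∧
      partialSum m f n x = ∫ t, f t * dirichlet m n x t ∂haar m := by
  have h : ∀ t, f t * dirichlet m n x t
      = ∑ k ∈ Finset.range n, psi m k x * (f t * (starRingEnd ℂ) (psi m k t)) := fun t => by
    rw [dirichlet, Finset.mul_sum]
    exact Finset.sum_congr rfl fun k _ => by ring
  have hi : ∀ k ∈ Finset.range n, Integrable
      (fun t => psi m k x * (f t * (starRingEnd ℂ) (psi m k t))) (haar m) := fun k _ =>
    (integrable_mul_conj_psi hf k).const_mul _
  simp only [h]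
  refine ⟨integrable_finsetSum _ hi, ?_⟩
  rw [integral_finsetSum _ hi, partialSum]
  exact Finset.sum_congr rfl fun k _ => by rw [integral_const_mul, fourierCoeff, mul_comm]

theorem sum_partialSum_eq_integral {m : ℕ → ℕ} [∀ k, NeZero (m k)] {f : VilenkinGroup m → ℂ}
    (hf : Integrable f (haar m)) (n : ℕ) (x : VilenkinGroup m) :
    ∑ k ∈ Finset.range n, partialSum m f k x = ∫ t, f t * fejerSum m n x t ∂haar m := by
  simp only [fejerSum, Finset.mul_sum]
  rw [integral_finsetSum _ fun k _ => (partialSum_eq_integral hf k x).1]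
  exact Finset.sum_congr rfl fun k _ => (partialSum_eq_integral hf k x).2

theorem eLpNorm_sum_partialSum_le {m : ℕ → ℕ} [∀ k, NeZero (m k)] (hm : ∀ k, 2 ≤ m k) {B : ℕ}
    (hB : ∀ k, m k ≤ B) {p : ℝ≥0∞} (hp1 : 1 ≤ p) (hp : p ≠ ∞) {f : VilenkinGroup m → ℂ}
    (hf : MemLp f p (haar m)) (n : ℕ) :
    eLpNorm (fun x => ∑ k ∈ Finset.range n, partialSum m f k x) p (haar m) ≤
      (B * B + B + B : ℕ) * n * eLpNorm f p (haar m) := by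
  have := isProbabilityMeasure_haar hm
  simp only [sum_partialSum_eq_integral (hf.integrable hp1)]
  refine eLpNorm_integral_mul_kernel_le (measurable_fejerSum m n)
    (ENNReal.mul_ne_top (ENNReal.natCast_ne_top _) (ENNReal.natCast_ne_top _)) (fun x => ?_)
    (lintegral_fejerSum_le hm hB n) hp1 hp hf.1
  refine le_trans (lintegral_mono fun t => ?_) (lintegral_fejerSum_le hm hB n x)
  rw [← conj_fejerSum, ← ofReal_norm, RCLike.norm_conj, ofReal_norm]

theorem measurable_partialSum (m : ℕ → ℕ) (f : VilenkinGroup m → ℂ) (n : ℕ) :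
    Measurable (partialSum m f n) :=
  Finset.measurable_fun_sum _ fun k _ => (measurable_psi m k).const_mul _

theorem measurable_tMean (m : ℕ → ℕ) (q : ℕ → ℝ) (f : VilenkinGroup m → ℂ) (n : ℕ) :
    Measurable (tMean m q f n) :=
  (Finset.measurable_fun_sum _ fun k _ => (measurable_partialSum m f k).const_mul _).const_mul _

/-! ### Summation by parts and uniform boundedness of the `T` means -/

/-- The variation that summation by parts produces from the weights `q`. -/
noncomputable def weightVariation (q : ℕ → ℝ) (n : ℕ) : ℝ :=
  |q (n - 1)| * n + ∑ i ∈ Finset.range (n - 1), |q (i + 1) - q i| * (i + 1 : ℕ)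

/-- The same summation by parts with every `S_k` replaced by 1; comparing it with `weightVariation`
evaluates the latter for monotone weights. -/
theorem Q_by_parts (q : ℕ → ℝ) (n : ℕ) :
    Q q n = q (n - 1) * n - ∑ i ∈ Finset.range (n - 1), (q (i + 1) - q i) * (i + 1 : ℕ) := by
  have := Finset.sum_range_by_parts q (fun _ => (1 : ℝ)) n
  simpa [Q] using this

theorem eLpNorm_sum_mul_partialSum_le {m : ℕ → ℕ} [∀ k, NeZero (m k)] (hm : ∀ k, 2 ≤ m k) {B : ℕ}
    (hB : ∀ k, m k ≤ B) {p : ℝ≥0∞} (hp1 : 1 ≤ p) (hp : p ≠ ∞) {f : VilenkinGroup m → ℂ}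
    (hf : MemLp f p (haar m)) (q : ℕ → ℝ) (n : ℕ) :
    eLpNorm (fun x => ∑ k ∈ Finset.range n, (q k : ℂ) * partialSum m f k x) p (haar m) ≤
      ENNReal.ofReal (weightVariation q n) *
        ((B * B + B + B : ℕ) * eLpNorm f p (haar m)) := by
  set A : ℕ → VilenkinGroup m → ℂ := fun n x => ∑ k ∈ Finset.range n, partialSum m f k x
  have hA : ∀ n, AEStronglyMeasurable (A n) (haar m) := fun n =>
    (Finset.measurable_fun_sum _ fun k _ => measurable_partialSum m f k).aestronglyMeasurable
  have hparts : (fun x => ∑ k ∈ Finset.range n, (q k : ℂ) * partialSum m f k x) =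
      (q (n - 1) : ℂ) • A n - ∑ i ∈ Finset.range (n - 1), ((q (i + 1) - q i : ℝ) : ℂ) • A (i + 1) := by
    funext x
    have := Finset.sum_range_by_parts (fun k => (q k : ℂ)) (fun k => partialSum m f k x) n
    simpa [A, Finset.sum_apply] using this
  have hsmul : ∀ (c : ℝ) n, eLpNorm ((c : ℂ) • A n) p (haar m) ≤
      ENNReal.ofReal (|c| * n) * ((B * B + B + B : ℕ) * eLpNorm f p (haar m)) := fun c n => by
    rw [eLpNorm_const_smul, ENNReal.ofReal_mul (abs_nonneg c), ENNReal.ofReal_natCast,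
      ← ofReal_norm, Complex.norm_real, Real.norm_eq_abs, mul_assoc]
    gcongr
    exact (eLpNorm_sum_partialSum_le hm hB hp1 hp hf n).trans_eq (by ring)
  rw [hparts]
  refine (eLpNorm_sub_le ((hA n).const_smul _)
    (Finset.aestronglyMeasurable_sum _ fun i _ => (hA _).const_smul _) hp1).trans ?_
  rw [weightVariation, ENNReal.ofReal_add (by positivity) (by positivity),
    ENNReal.ofReal_sum_of_nonneg fun _ _ => by positivity, add_mul, Finset.sum_mul]
  refine add_le_add (hsmul _ _) ((eLpNorm_sum_le (fun i _ => (hA _).const_smul _) hp1).trans ?_)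
  exact Finset.sum_le_sum fun i _ => hsmul _ _

theorem weightVariation_of_antitone {q : ℕ → ℝ} (hq : ∀ k, 0 ≤ q k) (h : Antitone q) (n : ℕ) :
    weightVariation q n = Q q n := by
  rw [Q_by_parts, weightVariation, abs_of_nonneg (hq _), sub_eq_add_neg, ← Finset.sum_neg_distrib]
  congr 1
  refine Finset.sum_congr rfl fun i _ => ?_
  rw [abs_of_nonpos (sub_nonpos.2 (h i.le_succ)), neg_mul]

theorem weightVariation_of_monotone {q : ℕ → ℝ} (hq : ∀ k, 0 ≤ q k) (h : Monotone q) (n : ℕ) :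
    weightVariation q n = 2 * (q (n - 1) * n) - Q q n := by
  rw [Q_by_parts, weightVariation, abs_of_nonneg (hq _)]
  have : ∀ i, |q (i + 1) - q i| = q (i + 1) - q i := fun i =>
    abs_of_nonneg (sub_nonneg.2 (h i.le_succ))
  simp only [this]
  ring

theorem Q_pos {q : ℕ → ℝ} (hq : ∀ k, 0 ≤ q k) (hq0 : 0 < q 0) {n : ℕ} (hn : 1 ≤ n) :
    0 < Q q n :=
  hq0.trans_le (Finset.single_le_sum (f := q) (fun k _ => hq k) (Finset.mem_range.2 hn))

theorem exists_weightVariation_le {q : ℕ → ℝ} (hq : ∀ k, 0 ≤ q k) (hq0 : 0 < q 0)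
    (hmono : Antitone q ∨
      (Monotone q ∧ (fun n : ℕ => q (n - 1) / Q q n) =O[atTop] (fun n : ℕ => 1 / (n : ℝ)))) :
    ∃ L : ℝ, 0 ≤ L ∧ ∀ᶠ n : ℕ in atTop, weightVariation q n ≤ L * Q q n := by
  rcases hmono with h | ⟨h, hO⟩
  · exact ⟨1, zero_le_one, Eventually.of_forall fun n => by
      rw [weightVariation_of_antitone hq h, one_mul]⟩
  · obtain ⟨c, hc, hb⟩ := hO.exists_pos
    -- The variation is `2 n q_{n-1} - Q_n`; the hypothesis gives `n q_{n-1} ≤ c Q_n`, and `-Q_n` is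
    -- dropped.
    refine ⟨2 * c, by positivity, ?_⟩
    filter_upwards [hb.bound, eventually_ge_atTop 1] with n hn hn1
    have hQ := Q_pos hq hq0 hn1
    have hn0 : (0 : ℝ) < n := by exact_mod_cast hn1
    rw [Real.norm_of_nonneg (div_nonneg (hq _) hQ.le), Real.norm_of_nonneg (by positivity),
      mul_one_div, div_le_div_iff₀ hQ hn0] at hn
    rw [weightVariation_of_monotone hq h]
    linarith

/-- The threshold in `n` is independent of `f`: it comes only from the weights. -/
theorem exists_eLpNorm_tMean_le {m : ℕ → ℕ} [∀ k, NeZero (m k)] (hm : ∀ k, 2 ≤ m k)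
    (hbdd : BddAbove (Set.range m)) {q : ℕ → ℝ} (hq : ∀ k, 0 ≤ q k) (hq0 : 0 < q 0)
    (hmono : Antitone q ∨
      (Monotone q ∧ (fun n : ℕ => q (n - 1) / Q q n) =O[atTop] (fun n : ℕ => 1 / (n : ℝ))))
    {p : ℝ≥0∞} (hp1 : 1 ≤ p) (hp : p ≠ ∞) :
    ∃ C : ℝ≥0∞, C ≠ ∞ ∧ ∀ᶠ n in atTop, ∀ f, MemLp f p (haar m) →
      eLpNorm (tMean m q f n) p (haar m) ≤ C * eLpNorm f p (haar m) := by
  obtain ⟨B, hB⟩ := hbdd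
  have hB : ∀ k, m k ≤ B := fun k => hB ⟨k, rfl⟩
  obtain ⟨L, hL, hev⟩ := exists_weightVariation_le hq hq0 hmono
  refine ⟨ENNReal.ofReal L * (B * B + B + B : ℕ),
    ENNReal.mul_ne_top ENNReal.ofReal_ne_top (ENNReal.natCast_ne_top _), ?_⟩
  filter_upwards [hev, eventually_ge_atTop 1] with n hn hn1 f hf
  have hQ := Q_pos hq hq0 hn1
  have : tMean m q f n = ((1 / Q q n : ℝ) : ℂ) •
      fun x => ∑ k ∈ Finset.range n, (q k : ℂ) * partialSum m f k x := rfl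
  rw [this, eLpNorm_const_smul, ← ofReal_norm, Complex.norm_real, Real.norm_of_nonneg (by positivity),
    mul_assoc (ENNReal.ofReal L)]
  refine (mul_le_mul_right (eLpNorm_sum_mul_partialSum_le hm hB hp1 hp hf q n) _).trans ?_
  rw [← mul_assoc, ← ENNReal.ofReal_mul (by positivity)]
  gcongr
  rw [one_div_mul_eq_div, div_le_iff₀ hQ]
  exact hn

/-! ### Orthonormality of the Vilenkin system -/

theorem integral_rademacher_pow_mul_conj {m : ℕ → ℕ} [∀ k, NeZero (m k)] (hm : ∀ k, 2 ≤ m k)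
    (k : ℕ) {a b : ℕ} (ha : a < m k) (hb : b < m k) (hab : a ≠ b) :
    ∫ y : ZMod (m k), (ZMod.stdAddChar y : ℂ) ^ a * (starRingEnd ℂ) (ZMod.stdAddChar y ^ b)
      ∂coordMeasure m k = 0 := by
  have := isProbabilityMeasure_coordMeasure hm
  have h : ∀ y : ZMod (m k), (ZMod.stdAddChar y : ℂ) ^ a * (starRingEnd ℂ) (ZMod.stdAddChar y ^ b)
      = ZMod.stdAddChar (y * ((a : ZMod (m k)) - (b : ZMod (m k)))) := fun y => by
    rw [map_pow, conj_stdAddChar, ← AddChar.map_nsmul_eq_pow, ← AddChar.map_nsmul_eq_pow,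
      ← AddChar.map_add_eq_mul]
    congr 1
    simp only [nsmul_eq_mul]
    ring
  have hne : (a : ZMod (m k)) - (b : ZMod (m k)) ≠ 0 := fun h0 => hab <| by
    have := (ZMod.natCast_eq_natCast_iff' a b (m k)).1 (sub_eq_zero.1 h0)
    rwa [Nat.mod_eq_of_lt ha, Nat.mod_eq_of_lt hb] at this
  simp only [h]
  rw [integral_fintype Integrable.of_finite]
  simp only [Measure.real, coordMeasure_singleton]
  rw [← Finset.smul_sum, AddChar.sum_mulShift _ (ZMod.isPrimitive_stdAddChar _), if_neg hne]
  simp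

theorem integral_finsetProd_haar {m : ℕ → ℕ} (hm : ∀ k, 2 ≤ m k) (s : Finset ℕ)
    (g : (k : ℕ) → ZMod (m k) → ℂ) :
    ∫ x, ∏ k ∈ s, g k (x k) ∂haar m = ∏ k ∈ s, ∫ y, g k y ∂coordMeasure m k := by
  have := isProbabilityMeasure_coordMeasure hm
  have hmeas : Measurable fun y : (k : s) → ZMod (m k) => ∏ k : s, g k (y k) :=
    Finset.measurable_fun_prod _ fun k _ =>
      (measurable_from_top (f := g k)).comp (measurable_pi_apply k)
  have h := integral_restrict_infinitePi (μ := coordMeasure m) hmeas.aestronglyMeasurable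
  rw [integral_fintype_prod_eq_prod (fun k : s => g k),
    Finset.prod_coe_sort s fun k => ∫ y, g k y ∂coordMeasure m k] at h
  rw [← h, haar]
  exact integral_congr_ae (ae_of_all _ fun x => (Finset.prod_coe_sort s fun k => g k (x k)).symm)

/-- Distinct indices differ in some digit, and the integral over that coordinate is a vanishing
character sum. -/
theorem integral_psi_mul_conj_psi {m : ℕ → ℕ} [∀ k, NeZero (m k)] (hm : ∀ k, 2 ≤ m k) (i j : ℕ) :
    ∫ x, psi m i x * (starRingEnd ℂ) (psi m j x) ∂haar m = if i = j then 1 else 0 := by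
  have := isProbabilityMeasure_haar hm
  have := isProbabilityMeasure_coordMeasure hm
  split_ifs with hij
  · subst hij
    simp [Complex.mul_conj, Complex.normSq_eq_norm_sq, norm_psi]
  set N := max i j
  obtain ⟨k, hkN, hk⟩ : ∃ k ∈ Finset.range N, digit m i k ≠ digit m j k := by
    by_contra! hcon
    have hsum : ∀ n ≤ N, ∑ k ∈ Finset.range N, digit m n k * M m k = n := fun n hn => by
      nth_rw 2 [← (sum_digit hm n).2]
      refine (Finset.sum_subset (Finset.range_mono hn) fun k _ hk => ?_).symm
      rw [digit_eq_zero hm (by simpa using hk), zero_mul]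
    apply hij
    rw [← hsum i (le_max_left _ _), ← hsum j (le_max_right _ _)]
    exact Finset.sum_congr rfl fun k hk => by rw [hcon k hk]
  have hprod : ∀ x, psi m i x * (starRingEnd ℂ) (psi m j x) = ∏ k ∈ Finset.range N,
      ((ZMod.stdAddChar (x k) : ℂ) ^ digit m i k *
        (starRingEnd ℂ) (ZMod.stdAddChar (x k) ^ digit m j k)) := fun x => by
    rw [psi_eq_prod hm (le_max_left i j), psi_eq_prod hm (le_max_right i j), map_prod,
      ← Finset.prod_mul_distrib]
    simp only [rademacher_eq_stdAddChar, N]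
  simp only [hprod]
  rw [integral_finsetProd_haar hm (Finset.range N) fun k (y : ZMod (m k)) =>
    (ZMod.stdAddChar y : ℂ) ^ digit m i k * (starRingEnd ℂ) (ZMod.stdAddChar y ^ digit m j k)]
  exact Finset.prod_eq_zero hkN
    (integral_rademacher_pow_mul_conj hm k ((sum_digit hm i).1 k) ((sum_digit hm j).1 k) hk)

theorem partialSum_psi {m : ℕ → ℕ} [∀ k, NeZero (m k)] (hm : ∀ k, 2 ≤ m k) (j n : ℕ)
    (x : VilenkinGroup m) : partialSum m (psi m j) n x = if j < n then psi m j x else 0 := by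
  simp [partialSum, fourierCoeff, integral_psi_mul_conj_psi hm]

theorem memLp_psi {m : ℕ → ℕ} [∀ k, NeZero (m k)] (hm : ∀ k, 2 ≤ m k) (p : ℝ≥0∞) (n : ℕ) :
    MemLp (psi m n) p (haar m) := by
  have := isProbabilityMeasure_haar hm
  exact MemLp.of_bound (measurable_psi m n).aestronglyMeasurable 1
    (ae_of_all _ fun x => (norm_psi m n x).le)

/-! ### Density of the Vilenkin polynomials -/

/-- The Vilenkin polynomials. -/
noncomputable def polynomials (m : ℕ → ℕ) : Submodule ℂ (VilenkinGroup m → ℂ) :=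
  Submodule.span ℂ (Set.range (psi m))

theorem memLp_of_mem_polynomials {m : ℕ → ℕ} [∀ k, NeZero (m k)] (hm : ∀ k, 2 ≤ m k) (p : ℝ≥0∞)
    {g : VilenkinGroup m → ℂ} (hg : g ∈ polynomials m) : MemLp g p (haar m) := by
  induction hg using Submodule.span_induction with
  | mem x h => obtain ⟨n, rfl⟩ := h; exact memLp_psi hm p n
  | zero => exact MemLp.zero
  | add x y _ _ hx hy => exact hx.add hy
  | smul a x _ hx => exact hx.const_smul a

/-- The set of points which agree with `a` in the first `N` coordinates. -/
def cylinder (m : ℕ → ℕ) (N : ℕ) (a : VilenkinGroup m) : Set (VilenkinGroup m) :=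
  {x | ∀ j < N, x j = a j}

theorem isPiSystem_cylinder (m : ℕ → ℕ) :
    IsPiSystem (Set.range fun c : ℕ × VilenkinGroup m => cylinder m c.1 c.2) := by
  rintro _ ⟨⟨N, a⟩, rfl⟩ _ ⟨⟨N', b⟩, rfl⟩ ⟨y, hy, hy'⟩
  refine ⟨(max N N', y), Set.ext fun x => ?_⟩
  simp only [cylinder, Set.mem_ofPred_eq, Set.mem_inter_iff] at hy hy' ⊢
  refine ⟨fun h => ⟨fun j hj => ?_, fun j hj => ?_⟩, fun h j hj => ?_⟩
  · rw [h j (hj.trans_le (le_max_left _ _)), hy j hj]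
  · rw [h j (hj.trans_le (le_max_right _ _)), hy' j hj]
  · rcases lt_max_iff.1 hj with hj | hj
    · rw [h.1 j hj, hy j hj]
    · rw [h.2 j hj, hy' j hj]

theorem generateFrom_cylinder (m : ℕ → ℕ) [∀ k, NeZero (m k)] :
    (inferInstance : MeasurableSpace (VilenkinGroup m)) = MeasurableSpace.generateFrom
      (Set.range fun c : ℕ × VilenkinGroup m => cylinder m c.1 c.2) := by
  apply le_antisymm
  · refine iSup_le fun k => ?_
    rintro _ ⟨s, -, rfl⟩
    -- Padding by zeros picks a centre for each cylinder of length `k + 1`; an event in coordinate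
    -- `k` is a finite union of these.
    let ext : ((j : Fin (k + 1)) → ZMod (m j)) → VilenkinGroup m := fun b j =>
      if h : j < k + 1 then b ⟨j, h⟩ else 0
    have : (fun x : VilenkinGroup m => x k) ⁻¹' s =
        ⋃ b ∈ {b : (j : Fin (k + 1)) → ZMod (m j) | b (Fin.last k) ∈ s},
          cylinder m (k + 1) (ext b) := by
      ext x
      simp only [Set.mem_preimage, Set.mem_iUnion, cylinder, Set.mem_ofPred_eq, exists_prop]
      constructor
      · exact fun hx => ⟨fun j => x j, hx, fun j hj => by simp only [ext, dif_pos hj]⟩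
      · rintro ⟨b, hb, hx⟩
        have := hx k k.lt_succ_self
        simp only [ext, Nat.lt_succ_self, dif_pos] at this
        rw [this]
        exact hb
    rw [this]
    exact MeasurableSet.biUnion (Set.to_countable _) fun b _ =>
      MeasurableSpace.measurableSet_generateFrom ⟨(k + 1, ext b), rfl⟩
  · refine MeasurableSpace.generateFrom_le ?_
    rintro _ ⟨⟨N, a⟩, rfl⟩
    have : cylinder m N a = ⋂ j ∈ Finset.range N, (fun x : VilenkinGroup m => x j) ⁻¹' {a j} := by
      ext x; simp [cylinder]
    simp only [this]
    exact Finset.measurableSet_biInter _ fun j _ =>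
      measurable_pi_apply j (measurableSet_singleton _)

/-- The kernel `D_{M_N}(·, a)` is a polynomial, and by its product form it equals `∏_{j<N} m_j`
times this indicator. -/
theorem indicator_cylinder_mem_polynomials {m : ℕ → ℕ} [∀ k, NeZero (m k)] (hm : ∀ k, 2 ≤ m k)
    (N : ℕ) (a : VilenkinGroup m) :
    (cylinder m N a).indicator (fun _ => (1 : ℂ)) ∈ polynomials m := by
  set c : ℂ := ∏ j ∈ Finset.range N, (m j : ℂ)
  have hc : c ≠ 0 := Finset.prod_ne_zero_iff.2 fun j _ => by exact_mod_cast NeZero.ne (m j)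
  have : (cylinder m N a).indicator (fun _ => (1 : ℂ)) =
      c⁻¹ • ∑ j ∈ Finset.range (M m N), (starRingEnd ℂ) (psi m j a) • psi m j := by
    funext x
    have h1 : (∑ j ∈ Finset.range (M m N), (starRingEnd ℂ) (psi m j a) • psi m j) x
        = ∏ j ∈ Finset.range N, coordKernel m j x a := by
      rw [← dirichlet_M hm, dirichlet, Finset.sum_apply]
      exact Finset.sum_congr rfl fun j _ => by simp [mul_comm]
    rw [Pi.smul_apply, h1]
    simp only [coordKernel_eq_ite]
    by_cases hx : x ∈ cylinder m N a
    · rw [Set.indicator_of_mem hx, Finset.prod_congr rfl fun j hj =>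
        if_pos (hx j (Finset.mem_range.1 hj)), smul_eq_mul, inv_mul_cancel₀ hc]
    · rw [Set.indicator_of_notMem hx]
      obtain ⟨j, hj, hne⟩ : ∃ j < N, x j ≠ a j := by simpa [cylinder] using hx
      rw [Finset.prod_eq_zero (Finset.mem_range.2 hj) (if_neg hne), smul_zero]
  rw [this]
  exact Submodule.smul_mem _ _ (Submodule.sum_mem _ fun j _ =>
    Submodule.smul_mem _ _ (Submodule.subset_span ⟨j, rfl⟩))

/-- A π-λ argument from cylinders. For disjoint unions, the tail has small measure, hence small `Lᵖ`
norm since `p` is finite, and finitely many sets remain. -/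
theorem exists_polynomial_near_indicator {m : ℕ → ℕ} [∀ k, NeZero (m k)] (hm : ∀ k, 2 ≤ m k)
    {p : ℝ≥0∞} (hp1 : 1 ≤ p) (hp : p ≠ ∞) {s : Set (VilenkinGroup m)} (hs : MeasurableSet s) :
    ∀ ε : ℝ≥0∞, ε ≠ 0 →
      ∃ g ∈ polynomials m, eLpNorm (g - s.indicator fun _ => (1 : ℂ)) p (haar m) ≤ ε := by
  have := isProbabilityMeasure_haar hm
  have hp0 : p ≠ 0 := (zero_lt_one.trans_le hp1).ne'
  have hone : (fun _ => (1 : ℂ)) ∈ polynomials m :=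
    Submodule.subset_span ⟨0, funext fun x => psi_zero m x⟩
  have hind : ∀ s : Set (VilenkinGroup m), MeasurableSet s →
      AEStronglyMeasurable (s.indicator fun _ => (1 : ℂ)) (haar m) := fun s hs =>
    aestronglyMeasurable_const.indicator hs
  induction s, hs using MeasurableSpace.induction_on_inter (generateFrom_cylinder m)
    (isPiSystem_cylinder m) with
  | empty => exact fun ε _ => ⟨0, Submodule.zero_mem _, by simp⟩
  | basic t ht =>
    obtain ⟨⟨N, a⟩, rfl⟩ := ht
    exact fun ε _ => ⟨_, indicator_cylinder_mem_polynomials hm N a, by simp⟩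
  | compl t ht ih =>
    intro ε hε
    obtain ⟨g, hg, hle⟩ := ih ε hε
    refine ⟨(fun _ => 1) - g, Submodule.sub_mem _ hone hg, ?_⟩
    rw [Set.indicator_compl]
    rwa [sub_sub_sub_cancel_left, ← neg_sub, eLpNorm_neg]
  | iUnion f hd hf ih =>
    intro ε hε
    have hε2 : ε / 2 ≠ 0 := (ENNReal.half_pos hε).ne'
    obtain ⟨δ, hδ, hδε⟩ := exists_eLpNorm_indicator_le (μ := haar m) hp (1 : ℂ) hε2
    have htend : Tendsto (fun n => haar m (⋃ i ≥ n, f i)) atTop (𝓝 0) :=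
      tendsto_measure_biUnion_Ici_zero_of_pairwise_disjoint (fun i => (hf i).nullMeasurableSet) hd
    obtain ⟨n, hn⟩ := (htend.eventually (ge_mem_nhds (by exact_mod_cast hδ : (0 : ℝ≥0∞) < δ))).exists
    set T := ⋃ i ≥ n, f i
    have hTm : MeasurableSet T := MeasurableSet.iUnion fun i => MeasurableSet.iUnion fun _ => hf i
    -- Dividing by `n + 1` rather than `n` allows `n = 0`.
    have hε3 : ε / 2 / (n + 1 : ℕ) ≠ 0 := ENNReal.div_ne_zero.2 ⟨hε2, ENNReal.natCast_ne_top _⟩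
    choose g hg hgle using fun i => ih i _ hε3
    have hsplit : (⋃ i, f i).indicator (fun _ => (1 : ℂ)) =
        ∑ i ∈ Finset.range n, (f i).indicator (fun _ => 1) + T.indicator fun _ => 1 := by
      have h1 : (⋃ i, f i) = (⋃ i ∈ Finset.range n, f i) ∪ T := by
        ext x
        simp only [T, Set.mem_iUnion, Set.mem_union, Finset.mem_range, exists_prop]
        constructor
        · rintro ⟨i, hi⟩
          rcases lt_or_ge i n with h | h
          exacts [Or.inl ⟨i, h, hi⟩, Or.inr ⟨i, h, hi⟩]
        · rintro (⟨i, -, hi⟩ | ⟨i, -, hi⟩) <;> exact ⟨i, hi⟩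
      have h2 : Disjoint (⋃ i ∈ Finset.range n, f i) T := by
        simp only [T, Set.disjoint_iUnion_left, Set.disjoint_iUnion_right, Finset.mem_range]
        exact fun i hi j hj => hd (by omega)
      rw [h1, Set.indicator_union_of_disjoint h2, Finset.indicator_biUnion]
      · funext x; simp
      · exact fun i _ j _ hij => hd hij
    refine ⟨∑ i ∈ Finset.range n, g i, Submodule.sum_mem _ fun i _ => hg i, ?_⟩
    have hgm : ∀ i, AEStronglyMeasurable (g i) (haar m) := fun i =>
      (memLp_of_mem_polynomials hm p (hg i)).1
    rw [hsplit, ← sub_sub, ← Finset.sum_sub_distrib]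
    refine (eLpNorm_sub_le (Finset.aestronglyMeasurable_sum _ fun i _ => (hgm i).sub (hind _ (hf i)))
      (hind _ hTm) hp1).trans ?_
    rw [← ENNReal.add_halves ε]
    refine add_le_add ?_ (hδε T hn)
    refine (eLpNorm_sum_le (fun i _ => (hgm i).sub (hind _ (hf i))) hp1).trans ?_
    refine (Finset.sum_le_card_nsmul _ _ _ fun i _ => hgle i).trans ?_
    rw [Finset.card_range, nsmul_eq_mul]
    calc (n : ℝ≥0∞) * (ε / 2 / (n + 1 : ℕ)) ≤ (n + 1 : ℕ) * (ε / 2 / (n + 1 : ℕ)) := by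
          gcongr; exact n.le_succ
      _ = ε / 2 := ENNReal.mul_div_cancel (by positivity) (ENNReal.natCast_ne_top _)

/-- The Vilenkin polynomials are dense in `Lᵖ` for finite `p`. -/
theorem exists_polynomial_near {m : ℕ → ℕ} [∀ k, NeZero (m k)] (hm : ∀ k, 2 ≤ m k)
    {p : ℝ≥0∞} (hp1 : 1 ≤ p) (hp : p ≠ ∞) {f : VilenkinGroup m → ℂ} (hf : MemLp f p (haar m))
    {ε : ℝ≥0∞} (hε : ε ≠ 0) : ∃ g, eLpNorm (f - g) p (haar m) ≤ ε ∧ g ∈ polynomials m := by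
  refine MemLp.induction_dense hp (fun g => g ∈ polynomials m) (fun c s hs _ ε hε => ?_)
    (fun f g => Submodule.add_mem _) (fun g hg => (memLp_of_mem_polynomials hm p hg).1) hf hε
  obtain ⟨g, hg, hle⟩ := exists_polynomial_near_indicator hm hp1 hp hs (ε / (‖c‖ₑ + 1))
    (ENNReal.div_ne_zero.2 ⟨hε, by simp⟩)
  refine ⟨c • g, ?_, Submodule.smul_mem _ _ hg⟩
  have : c • g - s.indicator (fun _ => c) = c • (g - s.indicator fun _ => (1 : ℂ)) := by
    funext x
    by_cases hx : x ∈ s <;> simp [hx, mul_sub]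
  rw [this, eLpNorm_const_smul]
  calc ‖c‖ₑ * eLpNorm (g - s.indicator fun _ => (1 : ℂ)) p (haar m)
      ≤ (‖c‖ₑ + 1) * (ε / (‖c‖ₑ + 1)) := by gcongr; exact le_self_add
    _ = ε := ENNReal.mul_div_cancel (by simp) (by simp)

/-! ### Convergence on polynomials -/

theorem fourierCoeff_add {m : ℕ → ℕ} [∀ k, NeZero (m k)] {f g : VilenkinGroup m → ℂ}
    (hf : Integrable f (haar m)) (hg : Integrable g (haar m)) (k : ℕ) :
    fourierCoeff m (f + g) k = fourierCoeff m f k + fourierCoeff m g k := by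
  simp only [fourierCoeff, Pi.add_apply, add_mul]
  exact integral_add (integrable_mul_conj_psi hf k) (integrable_mul_conj_psi hg k)

theorem tMean_add {m : ℕ → ℕ} [∀ k, NeZero (m k)] {f g : VilenkinGroup m → ℂ}
    (hf : Integrable f (haar m)) (hg : Integrable g (haar m)) (q : ℕ → ℝ) (n : ℕ) :
    tMean m q (f + g) n = tMean m q f n + tMean m q g n := by
  funext x
  simp only [tMean, partialSum, fourierCoeff_add hf hg, Pi.add_apply, add_mul, mul_add,
    Finset.sum_add_distrib]

theorem tMean_smul (m : ℕ → ℕ) (c : ℂ) (f : VilenkinGroup m → ℂ) (q : ℕ → ℝ) (n : ℕ) :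
    tMean m q (c • f) n = c • tMean m q f n := by
  funext x
  simp only [tMean, partialSum, fourierCoeff, Pi.smul_apply, smul_eq_mul, mul_assoc,
    integral_const_mul, Finset.mul_sum]
  refine Finset.sum_congr rfl fun k _ => Finset.sum_congr rfl fun j _ => ?_
  ring

/-- `S_k` fixes `ψ_j` for `k > j` and kills it for `k ≤ j`, so exactly the weights `q_0, …, q_j` are
lost; hence `Q_{j+1}`. -/
theorem tMean_psi_sub_psi {m : ℕ → ℕ} [∀ k, NeZero (m k)] (hm : ∀ k, 2 ≤ m k) {q : ℕ → ℝ}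
    (j n : ℕ) (hn : j < n) (hQ : Q q n ≠ 0) :
    tMean m q (psi m j) n - psi m j = ((-(Q q (j + 1) / Q q n) : ℝ) : ℂ) • psi m j := by
  have hsum : ∑ k ∈ Finset.range n, (q k : ℂ) * (if j < k then 1 else 0)
      = (Q q n - Q q (j + 1) : ℝ) := by
    obtain ⟨d, rfl⟩ := Nat.exists_eq_add_of_le (Nat.succ_le_of_lt hn)
    rw [Q, Q, Finset.sum_range_add, Finset.sum_range_add, add_sub_cancel_left,
      Finset.sum_eq_zero fun k hk => by
        rw [if_neg (by have := Finset.mem_range.1 hk; omega), mul_zero], zero_add]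
    push_cast
    exact Finset.sum_congr rfl fun k _ => by rw [if_pos (by omega), mul_one]
  funext x
  have hx : ∑ k ∈ Finset.range n, (q k : ℂ) * partialSum m (psi m j) k x
      = (Q q n - Q q (j + 1) : ℝ) * psi m j x := by
    rw [← hsum, Finset.sum_mul]
    refine Finset.sum_congr rfl fun k _ => ?_
    rw [partialSum_psi hm]
    split_ifs <;> simp
  have hQ' : (Q q n : ℂ) ≠ 0 := by exact_mod_cast hQ
  rw [Pi.sub_apply, tMean, hx, Pi.smul_apply, smul_eq_mul]
  push_cast
  field_simp
  ring

theorem tendsto_tMean_of_mem_polynomials {m : ℕ → ℕ} [∀ k, NeZero (m k)] (hm : ∀ k, 2 ≤ m k)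
    {q : ℕ → ℝ} (hQ : Tendsto (fun n => Q q n) atTop atTop) {p : ℝ≥0∞} (hp1 : 1 ≤ p)
    {g : VilenkinGroup m → ℂ} (hg : g ∈ polynomials m) :
    Tendsto (fun n => eLpNorm (tMean m q g n - g) p (haar m)) atTop (𝓝 0) := by
  have := isProbabilityMeasure_haar hm
  have hLp : ∀ {g}, g ∈ polynomials m → MemLp g p (haar m) := fun h =>
    memLp_of_mem_polynomials hm p h
  have hmeas : ∀ {g}, g ∈ polynomials m → ∀ n,
      AEStronglyMeasurable (tMean m q g n - g) (haar m) := fun h n =>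
    (measurable_tMean m q _ n).aestronglyMeasurable.sub (hLp h).1
  induction hg using Submodule.span_induction with
  | mem x h =>
    obtain ⟨j, rfl⟩ := h
    have hlim : Tendsto (fun n => -(Q q (j + 1) / Q q n)) atTop (𝓝 0) := by
      simpa using (hQ.const_div_atTop (Q q (j + 1))).neg
    have hlim' : Tendsto (fun n => ‖((-(Q q (j + 1) / Q q n) : ℝ) : ℂ)‖ₑ
        * eLpNorm (psi m j) p (haar m)) atTop (𝓝 0) := by
      have h1 : Tendsto (fun n => ‖((-(Q q (j + 1) / Q q n) : ℝ) : ℂ)‖ₑ) atTop (𝓝 0) := by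
        have hc : Tendsto (fun r : ℝ => ‖(r : ℂ)‖ₑ) (𝓝 0) (𝓝 0) := by
          simpa [Function.comp_def] using (continuous_enorm.comp Complex.continuous_ofReal).tendsto (0 : ℝ)
        exact hc.comp hlim
      simpa using ENNReal.Tendsto.mul_const h1 (Or.inr (memLp_psi hm p j).2.ne)
    refine hlim'.congr' ?_
    filter_upwards [eventually_gt_atTop j, hQ.eventually_ne_atTop 0] with n hn hn0
    rw [tMean_psi_sub_psi hm j n hn hn0, eLpNorm_const_smul]
  | zero =>
    have : ∀ n, tMean m q 0 n - 0 = (0 : VilenkinGroup m → ℂ) := fun n => by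
      funext x; simp [tMean, partialSum, fourierCoeff]
    simp [this]
  | add x y hx hy ihx ihy =>
    refine tendsto_of_tendsto_of_tendsto_of_le_of_le tendsto_const_nhds
      (by simpa using ihx.add ihy) (fun _ => zero_le) fun n => ?_
    have : tMean m q (x + y) n - (x + y) = (tMean m q x n - x) + (tMean m q y n - y) := by
      rw [tMean_add ((hLp hx).integrable hp1) ((hLp hy).integrable hp1)]
      abel
    simp only [this]
    exact eLpNorm_add_le (hmeas hx n) (hmeas hy n) hp1
  | smul a x hx ih =>
    have : ∀ n, tMean m q (a • x) n - a • x = a • (tMean m q x n - x) := fun n => by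
      rw [tMean_smul, smul_sub]
    simp only [this, eLpNorm_const_smul]
    simpa using ENNReal.Tendsto.const_mul ih (Or.inr enorm_ne_top)

end Vilenkin

/-! ### The approximation argument -/

theorem corollary4 (m : ℕ → ℕ) (hm : ∀ k, 2 ≤ m k) (hbdd : BddAbove (Set.range m))
    (q : ℕ → ℝ) (hq : ∀ k, 0 ≤ q k) (hq0 : 0 < q 0)
    (hQ : Tendsto (fun n => Vilenkin.Q q n) atTop atTop)
    (hmono : Antitone q ∨
      (Monotone q ∧
        (fun n : ℕ => q (n - 1) / Vilenkin.Q q n) =O[atTop] (fun n : ℕ => 1 / (n : ℝ))))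
    (p : ℝ≥0∞) (hp1 : 1 ≤ p) (hp : p ≠ ∞)
    (f : VilenkinGroup m → ℂ) (hf : MemLp f p (Vilenkin.haar m)) :
    Tendsto (fun n : ℕ =>
        eLpNorm (fun x => Vilenkin.tMean m q f n x - f x) p (Vilenkin.haar m))
      atTop (𝓝 0) := by
  have : ∀ k, NeZero (m k) := fun k => ⟨by have := hm k; omega⟩
  have := Vilenkin.isProbabilityMeasure_haar hm
  obtain ⟨C, hC, hbound⟩ := Vilenkin.exists_eLpNorm_tMean_le hm hbdd hq hq0 hmono hp1 hp
  rw [ENNReal.tendsto_nhds_zero]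
  intro ε hε
  -- Three errors share `ε`: `T_n (f - g)` costs `C` units of `ε / (C + 2)`, while `T_n g - g` and
  -- `f - g` cost one each.
  have hC2 : C + 2 ≠ ∞ := by simp [hC]
  obtain ⟨g, hfg, hg⟩ := Vilenkin.exists_polynomial_near hm hp1 hp hf
    (ENNReal.div_ne_zero.2 ⟨hε.ne', hC2⟩)
  have hgLp := Vilenkin.memLp_of_mem_polynomials hm p hg
  have hη : 0 < ε / (C + 2) := ENNReal.div_pos hε.ne' hC2
  filter_upwards [hbound, ENNReal.tendsto_nhds_zero.1
    (Vilenkin.tendsto_tMean_of_mem_polynomials hm hQ hp1 hg) _ hη] with n hn hgn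
  have hsplit : (fun x => Vilenkin.tMean m q f n x - f x) =
      Vilenkin.tMean m q (f - g) n + (Vilenkin.tMean m q g n - g) - (f - g) := by
    have h := Vilenkin.tMean_add ((hf.sub hgLp).integrable hp1) (hgLp.integrable hp1) q n
    rw [sub_add_cancel] at h
    funext x
    have hx := congrFun h x
    simp only [Pi.add_apply, Pi.sub_apply] at hx ⊢
    rw [hx]
    ring
  have hT := (Vilenkin.measurable_tMean m q (f - g) n).aestronglyMeasurable (μ := Vilenkin.haar m)
  have hTg := (Vilenkin.measurable_tMean m q g n).aestronglyMeasurable.sub hgLp.1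
  rw [hsplit]
  calc _ ≤ eLpNorm (Vilenkin.tMean m q (f - g) n) p (Vilenkin.haar m)
        + eLpNorm (Vilenkin.tMean m q g n - g) p (Vilenkin.haar m)
        + eLpNorm (f - g) p (Vilenkin.haar m) :=
        (eLpNorm_sub_le (hT.add hTg) (hf.sub hgLp).1 hp1).trans
          (add_le_add_left (eLpNorm_add_le hT hTg hp1) _)
    _ ≤ C * (ε / (C + 2)) + ε / (C + 2) + ε / (C + 2) := by
        gcongr
        exact (hn _ (hf.sub hgLp)).trans (by gcongr)
    _ = (C + 2) * (ε / (C + 2)) := by ring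
    _ = ε := ENNReal.mul_div_cancel (by simp) hC2
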